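/- Let $\mathbb{K}$ be an algebraically closed field containing $\mathbb{R}$ (for instance $\mathbb{C}$). The $k$-th signature tensor of a path $X:[0,1]\to\mathbb{R}^m$ is the tensor with entries $$\sigma_{i_1\cdots i_k}(X)=\int_0^1\int_0^{t_k}\cdots\int_0^{t_2}dX_{i_1}(t_1)\cdots dX_{i_k}(t_k).$$ Let $C_{\rm axis}$ be the path from $0$ to $(1,\dots,1)$ in $\mathbb{R}^m$ that runs through the linear steps $e_1,\dots,e_m$ in this order, and let $C_{\rm mono}$ be the path $t\mapsto(t,t^2,\dots,t^m)$. For $\bullet\in\{{\rm axis},{\rm mono}\}$, multiplying each of the $k$ sides of the tensor $\sigma^{(k)}(C_\bullet)$ by a $d\times m$ matrix $x=(x_{ij})$ gives a tensor $$\sigma^{(k)}(x)_{i_1\cdots i_k}=\sum_{j_1,\dots,j_k=1}^m\sigma_{j_1\cdots j_k}(C_\bullet)\,x_{i_1j_1}\cdots x_{i_kj_k}.$$ For real $x$ this is the signature tensor of the piecewise linear path in $\mathbb{R}^d$ whose $m$ steps are the columns of $x$ (if $\bullet={\rm axis}$), respectively of the polynomial path with coordinates $x_{i1}t+\cdots+x_{im}t^m$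 (if $\bullet={\rm mono}$). Let $\mathcal{L}_{d,k,m}$ (if $\bullet={\rm axis}$), respectively $\mathcal{P}_{d,k,m}$ (if $\bullet={\rm mono}$), be the Zariski closure of the image of the induced rational map $$\mathbb{P}^{dm-1}_{\mathbb{K}}\dashrightarrow\mathbb{P}^{d^k-1}_{\mathbb{K}},\qquad x\mapsto\sigma^{(k)}(x).$$ Such a variety is called *algebraically identifiable* if its dimension equals $dm-1$, and *rationally identifiable* if the rational map from $\mathbb{P}^{dm-1}_{\mathbb{K}}$ to it is birational. **Proposition.** Let $d\ge m\ge1$ and $k\ge3$ be integers. (a) If $\mathcal{L}_{m,3,m}$ is rationally identifiable, then so is $\mathcal{L}_{d,k,m}$; if $\mathcal{L}_{m,3,m}$ is algebraically identifiable, then so is $\mathcal{L}_{d,k,m}$. (b) If $\mathcal{P}_{m,3,m}$ is rationally identifiable, then so is $\mathcal{P}_{d,k,m}$; if $\mathcal{P}_{m,3,m}$ is algebraically identifiable, then so is $\mathcal{P}_{d,k,m}$. -/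

import Mathlib

open MvPolynomial

noncomputable section

/-! ## Signature tensors of paths -/

/-- The iterated integral
`∫_0^t ∫_0^{t_k} ⋯ ∫_0^{t_2} dX_{i_1}(t_1) ⋯ dX_{i_k}(t_k)` of a path `X` in `ℝⁿ`,
where `dX_i(s) = X_i'(s) ds`. The index word is `I = (i_1, …, i_k)`; the last letter belongs to
the outermost integral. -/
def iteratedIntegral {n : ℕ} (X : ℝ → Fin n → ℝ) : (k : ℕ) → (Fin k → Fin n) → ℝ → ℝ
  | 0, _, _ => 1
  | k + 1, I, t =>
      ∫ s in (0 : ℝ)..t,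
        iteratedIntegral X k (fun j => I j.castSucc) s * deriv (fun u => X u (I (Fin.last k))) s

/-- The `k`-th signature tensor `σ^{(k)}(X)` of a path `X : [0,1] → ℝⁿ`. -/
def signatureTensor {n : ℕ} (X : ℝ → Fin n → ℝ) (k : ℕ) (I : Fin k → Fin n) : ℝ :=
  iteratedIntegral X k I 1

/-- The canonical axis path in `ℝᵐ`: it runs through the steps `e_1, …, e_m` in this order, the
step `e_{j+1}` being traversed on `[j/m, (j+1)/m]` (indices `j` start at `0`). -/
def axisPath (m : ℕ) (t : ℝ) (j : Fin m) : ℝ :=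
  max 0 (min 1 ((m : ℝ) * t - (j : ℕ)))

/-- The canonical monomial path `t ↦ (t, t², …, tᵐ)` in `ℝᵐ`. -/
def monomialPath (m : ℕ) (t : ℝ) (j : Fin m) : ℝ :=
  t ^ ((j : ℕ) + 1)

/-! ## Signature maps

A piecewise linear path with `m` steps in `d`-space, or a polynomial path of degree `m` through the
origin, is encoded by a `d × m` matrix `x = (x_{ij})`; it is the image of the canonical path under
the linear map `x`. Its `k`-th signature tensor arises from that of the canonical path by
multiplying each of the `k` sides by `x`. The coordinates of the signature tensor are thus
polynomials in the unknowns `x_{ij}`. -/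

/-- Multiplication of the order `k` tensor `T` of format `m × ⋯ × m` by the generic `d × m`
matrix `(x_{ij})` on each of its `k` sides; the entry with index `I = (i_1, …, i_k)` is
`∑_J T_J x_{i_1 j_1} ⋯ x_{i_k j_k}`. -/
def tensorMap (K : Type*) [Field K] [Algebra ℝ K] (d k m : ℕ) (T : (Fin k → Fin m) → ℝ)
    (I : Fin k → Fin d) : MvPolynomial (Fin d × Fin m) K :=
  ∑ J : Fin k → Fin m, C (algebraMap ℝ K (T J)) * ∏ l : Fin k, X (I l, J l)

/-- The map sending a `d × m` matrix to the `k`-th signature tensor of the piecewise linear path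
in `d`-space whose `m` steps are the columns. The closure of the image of the induced rational map
of projective spaces is the piecewise linear signature variety `𝓛_{d,k,m}`. -/
def plSignatureMap (K : Type*) [Field K] [Algebra ℝ K] (d k m : ℕ) :
    (Fin k → Fin d) → MvPolynomial (Fin d × Fin m) K :=
  tensorMap K d k m (signatureTensor (axisPath m) k)

/-- The map sending a `d × m` matrix to the `k`-th signature tensor of the polynomial path
`X_i(t) = x_{i1} t + ⋯ + x_{im} t^m`. The closure of the image of the induced rational map
of projective spaces is the polynomial signature variety `𝓟_{d,k,m}`. -/
def polySignatureMap (K : Type*) [Field K] [Algebra ℝ K] (d k m : ℕ) :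
    (Fin k → Fin d) → MvPolynomial (Fin d × Fin m) K :=
  tensorMap K d k m (signatureTensor (monomialPath m) k)

/-! ## Image varieties of rational maps and identifiability

`F : τ → K[x_i : i ∈ ι]` is a family of forms of the same degree. It induces a rational map
`ℙ(K^ι) ⇢ ℙ(K^τ)`, and `𝓕 ⊆ ℙ(K^τ)` denotes the Zariski closure of the image of that map. -/

/-- The homogeneous prime ideal of `𝓕`: all polynomial relations among the forms `F a`. -/
def imageIdeal {K ι τ : Type*} [Field K] (F : τ → MvPolynomial ι K) : Ideal (MvPolynomial τ K) :=
  RingHom.ker (aeval F : MvPolynomial τ K →ₐ[K] MvPolynomial ι K)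

/-- The dimension of the irreducible projective variety `𝓕`, one less than the transcendence
degree over `K` of its homogeneous coordinate ring. (The transcendence degree is finite, since `τ`
is finite wherever this is used.) -/
def imageDim {K ι τ : Type*} [Field K] (F : τ → MvPolynomial ι K) : ℤ :=
  (Cardinal.toNat (Algebra.trdeg K (MvPolynomial τ K ⧸ imageIdeal F)) : ℤ) - 1

/-- `𝓕` is algebraically identifiable: its dimension is that of the projective space of
parameters. -/
def AlgebraicallyIdentifiable {K ι τ : Type*} [Field K] [Fintype ι]
    (F : τ → MvPolynomial ι K) : Prop :=
  imageDim F = (Fintype.card ι : ℤ) - 1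

/-- `𝓕` is rationally identifiable: the map `ℙ(K^ι) ⇢ 𝓕` is birational. That is, there is a
rational map `𝓕 ⇢ ℙ(K^ι)`, given by forms `G i` of the same degree in the coordinates on `ℙ(K^τ)`,
with `G ∘ F = id` and `F ∘ G = id` as rational maps of projective varieties: `G(F(x))` is a nonzero
multiple of the generic point `x`, and `F(G(s))` is nonzero and proportional to the generic point
`s` of `𝓕`. -/
def RationallyIdentifiable {K ι τ : Type*} [Field K] (F : τ → MvPolynomial ι K) : Prop :=
  ∃ (n : ℕ) (G : ι → MvPolynomial τ K),
    (∀ i, (G i).IsHomogeneous n) ∧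
    (∃ h : MvPolynomial ι K, h ≠ 0 ∧ ∀ i, aeval F (G i) = h * X i) ∧
    (∃ a, aeval G (F a) ∉ imageIdeal F) ∧
    (∀ a b, aeval G (F a) * X b - aeval G (F b) * X a ∈ imageIdeal F)

end

open MvPolynomial

noncomputable section

/-! Integration by parts gives the shuffle relation of a letter with a word: `σ_i σ_I` is the sum of
the `σ_J` over all insertions of `i` into `I`. It passes from the canonical path to the signature
map (`tensorMap_shuffle`). Iterating, `σ_i ^ r • σ^(3)` is a linear image of `σ^(3+r)`. Since `σ_i ≠
0`, the order 3 tensor is determined projectively by the higher one.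

To go from `m` to `d` rows, each choice of `m` rows gives a copy of the square problem. In the
rational case the recovered rows carry different scalars, which are matched through a shared entry
`x_00` (`HasRationalInverse.tensorMap_of_le`).

In the algebraic case, identifiability means that every `x_ij` is algebraic over the algebra
generated by the entries (`algebraicallyIdentifiable_iff`). Here `σ_i` itself is algebraic, its
`k`-th power being `k!` times an entry of order `k`, and transitivity concludes. -/

/-- A continuous function with locally integrable derivative which is continuously differentiable
off a countable set. -/
def IsPiecewiseSmooth (f : ℝ → ℝ) : Prop :=
  Continuous f ∧ (∀ a b, IntervalIntegrable (deriv f) MeasureTheory.volume a b) ∧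
    ∃ S : Set ℝ, S.Countable ∧ ∀ t ∉ S, DifferentiableAt ℝ f t ∧ ContinuousAt (deriv f) t

/-! ### Iterated integrals and the letter-word shuffle relation. -/

section IteratedIntegral

variable {n : ℕ} {X : ℝ → Fin n → ℝ}

lemma continuous_iteratedIntegral (hX : ∀ i, IsPiecewiseSmooth fun t => X t i) :
    ∀ (k : ℕ) (I : Fin k → Fin n), Continuous (iteratedIntegral X k I)
  | 0, _ => continuous_const
  | k + 1, I => intervalIntegral.continuous_primitive (fun a b =>
      ((hX (I (Fin.last k))).2.1 a b).continuousOn_mul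
        (continuous_iteratedIntegral hX k fun j => I j.castSucc).continuousOn) 0

lemma intervalIntegrable_iteratedIntegral_mul_deriv (hX : ∀ i, IsPiecewiseSmooth fun t => X t i)
    (k : ℕ) (I : Fin k → Fin n) (i : Fin n) (a b : ℝ) :
    IntervalIntegrable (fun s => iteratedIntegral X k I s * deriv (fun u => X u i) s)
      MeasureTheory.volume a b :=
  ((hX i).2.1 a b).continuousOn_mul (continuous_iteratedIntegral hX k I).continuousOn

lemma hasDerivAt_iteratedIntegral_succ (hX : ∀ i, IsPiecewiseSmooth fun t => X t i)
    (k : ℕ) (I : Fin (k + 1) → Fin n) {t : ℝ}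
    (ht : ContinuousAt (deriv fun u => X u (I (Fin.last k))) t) :
    HasDerivAt (iteratedIntegral X (k + 1) I)
      (iteratedIntegral X k (fun j => I j.castSucc) t * deriv (fun u => X u (I (Fin.last k))) t)
      t := by
  refine intervalIntegral.integral_hasDerivAt_right
    (intervalIntegrable_iteratedIntegral_mul_deriv hX k _ _ 0 t) ?_
    ((continuous_iteratedIntegral hX k _).continuousAt.mul ht)
  exact ((continuous_iteratedIntegral hX k _).measurable.mul
    (measurable_deriv _)).stronglyMeasurable.stronglyMeasurableAtFilter

lemma integral_deriv_of_isPiecewiseSmooth {f : ℝ → ℝ} (hf : IsPiecewiseSmooth f) (a b : ℝ) :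
    ∫ s in a..b, deriv f s = f b - f a := by
  obtain ⟨hc, hi, S, hS, h⟩ := hf
  exact MeasureTheory.integral_eq_of_hasDerivAt_off_countable f (deriv f) hS hc.continuousOn
    (fun x hx => (h x hx.2).1.hasDerivAt) (hi a b)

lemma insertNth_castSucc_apply_castSucc {α : Type*} {k : ℕ} (q : Fin (k + 1)) (x : α)
    (I : Fin (k + 1) → α) (j : Fin (k + 1)) :
    Fin.insertNth (α := fun _ => α) q.castSucc x I j.castSucc =
      Fin.insertNth (α := fun _ => α) q x (fun l : Fin k => I l.castSucc) j := by
  induction j using Fin.succAboveCases q with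
  | x => simp
  | p j => simp [← Fin.castSucc_succAbove_castSucc]

lemma insertNth_castSucc_apply_last {α : Type*} {k : ℕ} (q : Fin (k + 1)) (x : α)
    (I : Fin (k + 1) → α) :
    Fin.insertNth (α := fun _ => α) q.castSucc x I (Fin.last (k + 1)) = I (Fin.last k) := by
  have : Fin.last (k + 1) = q.castSucc.succAbove (Fin.last k) := by
    simp [Fin.succAbove_of_lt_succ]
  rw [this, Fin.insertNth_apply_succAbove]

/-- The shuffle product of a letter with a word. -/
lemma sub_mul_iteratedIntegral (hX : ∀ i, IsPiecewiseSmooth fun t => X t i) (j : Fin n) :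
    ∀ (k : ℕ) (I : Fin k → Fin n) (t : ℝ),
      (X t j - X 0 j) * iteratedIntegral X k I t =
        ∑ p : Fin (k + 1), iteratedIntegral X (k + 1) (Fin.insertNth (α := fun _ => Fin n) p j I) t
  | 0, I, t => by
      simp [iteratedIntegral, integral_deriv_of_isPiecewiseSmooth (hX j)]
  | k + 1, I, t => by
      -- Insertions before the end keep the last letter of `I` outermost, and the insertion at the
      -- end makes `j` outermost: these are the two terms of the product rule.
      rw [Fin.sum_univ_castSucc]
      have h1 : ∀ q : Fin (k + 1), iteratedIntegral X (k + 2)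
          (Fin.insertNth (α := fun _ => Fin n) q.castSucc j I) t =
          ∫ s in (0 : ℝ)..t, iteratedIntegral X (k + 1)
            (Fin.insertNth (α := fun _ => Fin n) q j fun l : Fin k => I l.castSucc) s *
            deriv (fun u => X u (I (Fin.last k))) s := by
        intro q
        rw [iteratedIntegral]
        simp only [insertNth_castSucc_apply_castSucc, insertNth_castSucc_apply_last]
      have h2 : iteratedIntegral X (k + 2)
          (Fin.insertNth (α := fun _ => Fin n) (Fin.last (k + 1)) j I) t =
          ∫ s in (0 : ℝ)..t, iteratedIntegral X (k + 1) I s * deriv (fun u => X u j) s := by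
        rw [iteratedIntegral]
        simp only [Fin.insertNth_last', Fin.snoc_castSucc, Fin.snoc_last]
      simp only [h1, h2]
      rw [← intervalIntegral.integral_finsetSum
        fun q _ => intervalIntegrable_iteratedIntegral_mul_deriv hX _ _ _ _ _]
      simp only [← Finset.sum_mul, ← sub_mul_iteratedIntegral hX j k]
      have hi : IntervalIntegrable (fun s => (X s j - X 0 j) *
          iteratedIntegral X k (fun l => I l.castSucc) s * deriv (fun u => X u (I (Fin.last k))) s)
          MeasureTheory.volume 0 t :=
        ((hX _).2.1 0 t).continuousOn_mul (((hX j).1.sub continuous_const).mul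
          (continuous_iteratedIntegral hX k _)).continuousOn
      rw [← intervalIntegral.integral_add hi
        (intervalIntegrable_iteratedIntegral_mul_deriv hX _ _ _ _ _)]
      obtain ⟨S, hS, hSd⟩ := (hX j).2.2
      obtain ⟨S', hS', hSd'⟩ := (hX (I (Fin.last k))).2.2
      rw [MeasureTheory.integral_eq_of_hasDerivAt_off_countable
        (fun s => (X s j - X 0 j) * iteratedIntegral X (k + 1) I s) _ (hS.union hS')
        (((hX j).1.sub continuous_const).mul (continuous_iteratedIntegral hX _ _)).continuousOn _
        (hi.add (intervalIntegrable_iteratedIntegral_mul_deriv hX _ _ _ _ _))]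
      · simp
      · intro s hs
        have hs1 : s ∉ S := fun h => hs.2 (Or.inl h)
        have hs2 : s ∉ S' := fun h => hs.2 (Or.inr h)
        exact (((hSd s hs1).1.hasDerivAt.sub_const (X 0 j)).fun_mul
          (hasDerivAt_iteratedIntegral_succ hX k I (hSd' s hs2).2)).congr_deriv (by ring)

lemma signatureTensor_shuffle (hX : ∀ i, IsPiecewiseSmooth fun t => X t i) (j : Fin n) (k : ℕ)
    (I : Fin k → Fin n) :
    signatureTensor X 1 (fun _ => j) * signatureTensor X k I =
      ∑ p : Fin (k + 1), signatureTensor X (k + 1) (Fin.insertNth (α := fun _ => Fin n) p j I) := by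
  unfold signatureTensor
  rw [← sub_mul_iteratedIntegral hX]
  simp [iteratedIntegral, integral_deriv_of_isPiecewiseSmooth (hX j)]

lemma signatureTensor_one (hX : ∀ i, IsPiecewiseSmooth fun t => X t i) (j : Fin n) :
    signatureTensor X 1 (fun _ => j) = X 1 j - X 0 j := by
  simp [signatureTensor, iteratedIntegral, integral_deriv_of_isPiecewiseSmooth (hX j)]

end IteratedIntegral

/-! ### The two canonical paths. -/

lemma isPiecewiseSmooth_monomialPath (m : ℕ) (j : Fin m) :
    IsPiecewiseSmooth fun t => monomialPath m t j := by
  have h : ContDiff ℝ 1 fun t : ℝ => monomialPath m t j := by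
    unfold monomialPath; fun_prop
  have hd := h.continuous_deriv le_rfl
  exact ⟨h.continuous, fun a b => hd.intervalIntegrable a b, ∅, Set.countable_empty,
    fun t _ => ⟨(h.differentiable one_ne_zero) t, hd.continuousAt⟩⟩

lemma isPiecewiseSmooth_axisPath (m : ℕ) (j : Fin m) :
    IsPiecewiseSmooth fun t => axisPath m t j := by
  have hm : (0 : ℝ) < m := by exact_mod_cast j.pos
  have hc : Continuous fun t => axisPath m t j := by unfold axisPath; fun_prop
  have hl : LipschitzWith (m : NNReal) fun t => axisPath m t j := by
    unfold axisPath
    refine LipschitzWith.const_max (LipschitzWith.const_min ?_ 1) 0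
    refine LipschitzWith.of_dist_le_mul fun x y => ?_
    simp only [Real.dist_eq, NNReal.coe_natCast]
    rw [sub_sub_sub_cancel_right, ← mul_sub, abs_mul, abs_of_pos hm]
  refine ⟨hc, fun a b => ?_, {(j : ℝ) / m, ((j : ℝ) + 1) / m}, (Set.toFinite _).countable, ?_⟩
  · refine (intervalIntegrable_const (c := (m : ℝ))).mono_fun
      (measurable_deriv _).aestronglyMeasurable (Filter.Eventually.of_forall fun x => ?_)
    simpa using norm_deriv_le_of_lipschitz hl (x₀ := x)
  · intro t ht
    have key : ∃ a b : ℝ, (fun t => axisPath m t j) =ᶠ[nhds t] fun t => a * t + b := by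
      simp only [Set.mem_insert_iff, Set.mem_singleton_iff, not_or, ← ne_eq] at ht
      have c0 : Continuous fun s : ℝ => (m : ℝ) * s - (j : ℕ) := by fun_prop
      have e0 : (m : ℝ) * t - j ≠ 0 := fun h => ht.1 (by field_simp; linarith)
      have e1 : (m : ℝ) * t - j ≠ 1 := fun h => ht.2 (by field_simp; linarith)
      rcases lt_or_gt_of_ne e0 with h0 | h0
      · refine ⟨0, 0, ?_⟩
        filter_upwards [c0.continuousAt.eventually_lt_const h0] with s hs
        simp only [axisPath]
        rw [max_eq_left ((min_le_right _ _).trans hs.le)]; simp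
      rcases lt_or_gt_of_ne e1 with h1 | h1
      · refine ⟨m, -j, ?_⟩
        filter_upwards [c0.continuousAt.eventually_lt_const h1,
          c0.continuousAt.eventually_const_lt h0] with s hs hs'
        simp only [axisPath]
        rw [min_eq_right hs.le, max_eq_right hs'.le]; ring
      · refine ⟨0, 1, ?_⟩
        filter_upwards [c0.continuousAt.eventually_const_lt h1] with s hs
        simp only [axisPath]
        rw [min_eq_left hs.le]; simp
    obtain ⟨a, b, hab⟩ := key
    have hsm : ContDiff ℝ 1 fun t : ℝ => a * t + b := by fun_prop
    exact ⟨(hsm.differentiable one_ne_zero t).congr_of_eventuallyEq hab,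
      (hsm.continuous_deriv le_rfl).continuousAt.congr hab.deriv.symm⟩

lemma signatureTensor_axisPath_one (m : ℕ) (j : Fin m) :
    signatureTensor (axisPath m) 1 (fun _ => j) = 1 := by
  have hj : ((j : ℕ) : ℝ) + 1 ≤ m := by exact_mod_cast j.2
  have hj0 : (0 : ℝ) ≤ (j : ℕ) := Nat.cast_nonneg _
  rw [signatureTensor_one (isPiecewiseSmooth_axisPath m)]
  unfold axisPath
  rw [min_eq_left (by linarith), max_eq_right zero_le_one,
    min_eq_right (by linarith), max_eq_left (by linarith), sub_zero]

lemma signatureTensor_monomialPath_one (m : ℕ) (j : Fin m) :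
    signatureTensor (monomialPath m) 1 (fun _ => j) = 1 := by
  rw [signatureTensor_one (isPiecewiseSmooth_monomialPath m)]
  simp [monomialPath]
end

noncomputable section

lemma aeval_mul_of_isHomogeneous {R σ A : Type*} [CommSemiring R] [CommSemiring A]
    [Algebra R A] {p : MvPolynomial σ R} {n : ℕ} (hp : p.IsHomogeneous n) (c : A) (f : σ → A) :
    aeval (fun a => c * f a) p = c ^ n * aeval f p := by
  rw [aeval_def, aeval_def, eval₂_eq, eval₂_eq, Finset.mul_sum]
  refine Finset.sum_congr rfl fun e he => ?_
  have hd : ∑ i ∈ e.support, e i = n := by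
    have := hp (mem_support_iff.mp he)
    simpa [Finsupp.weight_apply, Finsupp.sum] using this
  simp only [mul_pow, Finset.prod_mul_distrib, Finset.prod_pow_eq_pow_sum, hd]
  ring

/-! ### Shuffle relations for the signature maps. -/

section TensorMap

/-- Weights whose contractions satisfy the shuffle relations for products with a letter. -/
def IsShuffleFamily {m : ℕ} (T : ∀ k : ℕ, (Fin k → Fin m) → ℝ) : Prop :=
  (∀ j, T 1 (fun _ => j) = 1) ∧ ∀ (j : Fin m) (k : ℕ) (I : Fin k → Fin m),
    T 1 (fun _ => j) * T k I =
      ∑ p : Fin (k + 1), T (k + 1) (Fin.insertNth (α := fun _ => Fin m) p j I)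

lemma isShuffleFamily_axisPath (m : ℕ) : IsShuffleFamily (signatureTensor (axisPath m)) :=
  ⟨signatureTensor_axisPath_one m, signatureTensor_shuffle (isPiecewiseSmooth_axisPath m)⟩

lemma isShuffleFamily_monomialPath (m : ℕ) : IsShuffleFamily (signatureTensor (monomialPath m)) :=
  ⟨signatureTensor_monomialPath_one m,
    signatureTensor_shuffle (isPiecewiseSmooth_monomialPath m)⟩

variable {K : Type*} [Field K] [Algebra ℝ K] {d m : ℕ}

lemma tensorMap_isHomogeneous (k : ℕ) (T : (Fin k → Fin m) → ℝ) (I : Fin k → Fin d) :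
    (tensorMap K d k m T I).IsHomogeneous k := by
  refine IsHomogeneous.sum _ _ _ fun J _ => ?_
  have h := IsHomogeneous.prod (Finset.univ : Finset (Fin k))
    (fun l => (X (I l, J l) : MvPolynomial (Fin d × Fin m) K)) (fun _ => 1)
    fun l _ => isHomogeneous_X K _
  simpa using (isHomogeneous_C _ (algebraMap ℝ K (T J))).mul h

lemma rename_tensorMap {d' : ℕ} (s : Fin d → Fin d') (k : ℕ) (T : (Fin k → Fin m) → ℝ)
    (I : Fin k → Fin d) :
    rename (Prod.map s id) (tensorMap K d k m T I) = tensorMap K d' k m T (s ∘ I) := by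
  simp [tensorMap, map_sum, map_prod]

lemma tensorMap_one (T : (Fin 1 → Fin m) → ℝ) (i : Fin 1 → Fin d) :
    tensorMap K d 1 m T i = ∑ j, C (algebraMap ℝ K (T fun _ => j)) * X (i 0, j) := by
  rw [tensorMap, ← (Equiv.funUnique (Fin 1) (Fin m)).symm.sum_comp]
  simp [Equiv.funUnique, uniqueElim_const]
  rfl

variable {T : ∀ k : ℕ, (Fin k → Fin m) → ℝ}

lemma tensorMap_shuffle (hT : IsShuffleFamily T) (i : Fin d) (k : ℕ) (I : Fin k → Fin d) :
    tensorMap K d 1 m (T 1) (fun _ => i) * tensorMap K d k m (T k) I =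
      ∑ p : Fin (k + 1),
        tensorMap K d (k + 1) m (T (k + 1)) (Fin.insertNth (α := fun _ => Fin d) p i I) := by
  have h : ∀ p : Fin (k + 1),
      tensorMap K d (k + 1) m (T (k + 1)) (Fin.insertNth (α := fun _ => Fin d) p i I) =
      ∑ j : Fin m, ∑ J : Fin k → Fin m,
        C (algebraMap ℝ K (T (k + 1) (Fin.insertNth (α := fun _ => Fin m) p j J))) *
          (X (i, j) * ∏ l, X (I l, J l)) := by
    intro p
    rw [tensorMap, ← (Fin.insertNthEquiv (fun _ => Fin m) p).sum_comp, Fintype.sum_prod_type]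
    simp [Fin.insertNthEquiv, Fin.prod_univ_succAbove _ p]
  simp only [h]
  rw [tensorMap_one, tensorMap, Finset.sum_mul_sum, Finset.sum_comm (s := Finset.univ (α := Fin (k + 1)))]
  refine Finset.sum_congr rfl fun j _ => ?_
  rw [Finset.sum_comm]
  refine Finset.sum_congr rfl fun J _ => ?_
  rw [← Finset.sum_mul, ← map_sum, ← map_sum, ← hT.2, map_mul, map_mul]
  ring

lemma tensorMap_one_ne_zero (hT : IsShuffleFamily T) (hm : 1 ≤ m) (i : Fin d) :
    tensorMap K d 1 m (T 1) (fun _ => i) ≠ 0 := by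
  intro h
  have h' := congrArg (coeff (Finsupp.single (i, (⟨0, hm⟩ : Fin m)) 1)) h
  rw [tensorMap_one] at h'
  simp [coeff_sum, hT.1, coeff_X, Finsupp.single_left_inj] at h'

/-- All insertions of `i` into a constant word coincide, so each new factor contributes the length
of the new word. -/
lemma tensorMap_one_pow (hT : IsShuffleFamily T) (i : Fin d) (k : ℕ) :
    tensorMap K d 1 m (T 1) (fun _ => i) ^ (k + 1) =
      (k + 1).factorial * tensorMap K d (k + 1) m (T (k + 1)) fun _ => i := by
  induction k with
  | zero => simp
  | succ k ih =>
    have h : ∀ p : Fin (k + 2), Fin.insertNth (α := fun _ => Fin d) p i (fun _ => i) =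
        fun _ => i := by
      intro p
      rw [Fin.insertNth_eq_iff]
      exact ⟨rfl, rfl⟩
    rw [pow_succ', ih, mul_left_comm, tensorMap_shuffle hT]
    simp only [h, Finset.sum_const, Finset.card_univ, Fintype.card_fin, nsmul_eq_mul]
    rw [Nat.factorial_succ (k + 1)]
    push_cast
    ring

lemma tensorMap_const_ne_zero (hT : IsShuffleFamily T) (hm : 1 ≤ m) (i : Fin d) (k : ℕ) :
    tensorMap K d (k + 1) m (T (k + 1)) (fun _ => i) ≠ 0 := fun h =>
  pow_ne_zero (k + 1) (tensorMap_one_ne_zero (K := K) hT hm i) (by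
    rw [tensorMap_one_pow hT, h, mul_zero])

/-- Each shuffle with `i` raises the order by one at the cost of a factor `σ_i`. This factor is
independent of `w`, hence invisible projectively. -/
lemma exists_isHomogeneous_aeval_tensorMap (hT : IsShuffleFamily T) (i : Fin d) (k r : ℕ) :
    ∃ L : (Fin k → Fin d) → MvPolynomial (Fin (k + r) → Fin d) K,
      (∀ w, (L w).IsHomogeneous 1) ∧ ∀ w, aeval (tensorMap K d (k + r) m (T (k + r))) (L w) =
        tensorMap K d 1 m (T 1) (fun _ => i) ^ r * tensorMap K d k m (T k) w := by
  induction r with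
  | zero => exact ⟨X, isHomogeneous_X K, fun w => by simp⟩
  | succ r ih =>
    obtain ⟨L, hL, hL'⟩ := ih
    let S : (Fin (k + r) → Fin d) → MvPolynomial (Fin (k + (r + 1)) → Fin d) K := fun w =>
      ∑ p : Fin (k + r + 1), X (Fin.insertNth (α := fun _ => Fin d) p i w)
    refine ⟨fun w => aeval S (L w), fun w => ?_, fun w => ?_⟩
    · exact (hL w).aeval S fun v => IsHomogeneous.sum _ _ _ fun p _ => isHomogeneous_X K _
    · have hS : ∀ v, aeval (tensorMap K d (k + (r + 1)) m (T (k + (r + 1)))) (S v) =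
          tensorMap K d 1 m (T 1) (fun _ => i) * tensorMap K d (k + r) m (T (k + r)) v := by
        intro v
        rw [tensorMap_shuffle hT]
        simp only [S, map_sum, aeval_X]
        rfl
      have h1 : aeval (tensorMap K d (k + (r + 1)) m (T (k + (r + 1)))) (aeval S (L w)) =
          aeval (fun v => tensorMap K d 1 m (T 1) (fun _ => i) *
            tensorMap K d (k + r) m (T (k + r)) v) (L w) := by
        rw [comp_aeval_apply]
        simp only [hS]
      rw [h1, aeval_mul_of_isHomogeneous (hL w), hL', pow_one, pow_succ']
      ring

end TensorMap
end

noncomputable section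

/-! ### Rational inverses. -/

section Rational

variable {K ι τ τ' : Type*} [Field K]

/-- There are forms of the same degree which send `F` to a nonzero multiple of the generic point. -/
def HasRationalInverse (F : τ → MvPolynomial ι K) : Prop :=
  ∃ (n : ℕ) (G : ι → MvPolynomial τ K), (∀ i, (G i).IsHomogeneous n) ∧
    ∃ h : MvPolynomial ι K, h ≠ 0 ∧ ∀ i, aeval F (G i) = h * X i

lemma RationallyIdentifiable.hasRationalInverse {F : τ → MvPolynomial ι K}
    (hF : RationallyIdentifiable F) : HasRationalInverse F :=
  let ⟨n, G, hG, hh, _⟩ := hF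
  ⟨n, G, hG, hh⟩

/-- A left inverse suffices: by homogeneity `F(G(F(x))) = F(h x) = h ^ e F(x)`. -/
lemma HasRationalInverse.rationallyIdentifiable {F : τ → MvPolynomial ι K} {e : ℕ}
    (hF : HasRationalInverse F) (he : ∀ a, (F a).IsHomogeneous e) (h0 : ∃ a, F a ≠ 0) :
    RationallyIdentifiable F := by
  obtain ⟨n, G, hG, h, hh, hGF⟩ := hF
  have key : ∀ a, aeval F (aeval G (F a)) = h ^ e * F a := by
    intro a
    rw [comp_aeval_apply]
    simp only [hGF]
    rw [aeval_mul_of_isHomogeneous (he a), aeval_X_left_apply]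
  refine ⟨n, G, hG, ⟨h, hh, hGF⟩, ?_, fun a b => ?_⟩
  · obtain ⟨a, ha⟩ := h0
    refine ⟨a, fun hmem => ?_⟩
    rw [imageIdeal, RingHom.mem_ker, key] at hmem
    exact mul_ne_zero (pow_ne_zero _ hh) ha hmem
  · rw [imageIdeal, RingHom.mem_ker, map_sub, map_mul, map_mul, key, key, aeval_X, aeval_X]
    ring

lemma HasRationalInverse.of_aeval {F : τ → MvPolynomial ι K} {F' : τ' → MvPolynomial ι K}
    (hF' : HasRationalInverse F') {e : ℕ} (L : τ' → MvPolynomial τ K)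
    (hL : ∀ a, (L a).IsHomogeneous e) {c : MvPolynomial ι K} (hc : c ≠ 0)
    (h : ∀ a, aeval F (L a) = c * F' a) : HasRationalInverse F := by
  obtain ⟨n, G, hG, g, hg, hGF⟩ := hF'
  refine ⟨e * n, fun i => aeval L (G i), fun i => (hG i).aeval L hL, c ^ n * g,
    mul_ne_zero (pow_ne_zero _ hc) hg, fun i => ?_⟩
  rw [comp_aeval_apply]
  simp only [h]
  rw [aeval_mul_of_isHomogeneous (hG i), hGF, mul_assoc]

end Rational

/-! ### From `m` rows to `d` rows, rationally. -/

section Extension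

variable {K : Type*} [Field K] [Algebra ℝ K] {d k m : ℕ} {T : (Fin k → Fin m) → ℝ}

/-- Words with letters in the range of `s` see only the rows selected by `s`. The degree `n` is
uniform in `s`, as gluing requires. -/
lemma exists_aeval_eq_of_embedding (hF : HasRationalInverse (tensorMap K m k m T)) :
    ∃ n : ℕ, ∀ s : Fin m ↪ Fin d, ∃ (G : Fin m × Fin m → MvPolynomial (Fin k → Fin d) K)
      (h : MvPolynomial (Fin d × Fin m) K), (∀ i, (G i).IsHomogeneous n) ∧ h ≠ 0 ∧
      ∀ a b, aeval (tensorMap K d k m T) (G (a, b)) = h * X (s a, b) := by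
  obtain ⟨n, G, hG, h, hh, hGF⟩ := hF
  refine ⟨n, fun s => ⟨fun i => rename (fun I => s ∘ I) (G i), rename (Prod.map s id) h,
    fun i => (hG i).rename_isHomogeneous, ?_, fun a b => ?_⟩⟩
  · rwa [Ne, map_eq_zero_iff _ (rename_injective _ (s.injective.prodMap Function.injective_id))]
  · have := congrArg (rename (Prod.map s id)) (hGF (a, b))
    rw [map_mul, rename_X, comp_aeval_apply] at this
    rw [aeval_rename]
    simp only [rename_tensorMap] at this
    exact this

/-- Row 0 is kept in every selection, to compare scales. This leaves a slot for row `i` only if `m ≥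
2`. -/
lemma exists_embedding_of_two_le (hm : 2 ≤ m) (hmd : m ≤ d) (i : Fin d) :
    ∃ s : Fin m ↪ Fin d, s ⟨0, by omega⟩ = ⟨0, by omega⟩ ∧ ∃ a, s a = i := by
  by_cases hi : (i : ℕ) < m
  · exact ⟨Fin.castLEEmb hmd, rfl, ⟨i, hi⟩, rfl⟩
  · refine ⟨(Fin.castLEEmb hmd).setValue ⟨1, by omega⟩ i, ?_, ⟨1, by omega⟩, by simp⟩
    rw [Function.Embedding.setValue_eq_of_ne]
    · rfl
    · simp
    · intro h
      apply hi
      rw [← h]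
      simp; omega

lemma HasRationalInverse.tensorMap_of_le (hm : 1 ≤ m) (hmd : m ≤ d) (hk : 1 ≤ k)
    (hF : HasRationalInverse (tensorMap K m k m T))
    (h0 : ∃ I, tensorMap K d k m T I ≠ 0) : HasRationalInverse (tensorMap K d k m T) := by
  -- For `m = 1` the entries are `c x_{i_1} ⋯ x_{i_k}`, and the words `(i, 0, …, 0)` already recover
  -- `x`.
  rcases hm.eq_or_lt with rfl | hm
  · obtain ⟨k, rfl⟩ := Nat.exists_eq_add_of_le' hk
    have hT : ∀ I, tensorMap K d (k + 1) 1 T I =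
        C (algebraMap ℝ K (T fun _ => 0)) * ∏ l, X (I l, 0) := by
      intro I
      rw [tensorMap, Fintype.sum_eq_single fun _ => (0 : Fin 1)]
      exact fun J hJ => absurd (Subsingleton.elim _ _) hJ
    have hc : C (algebraMap ℝ K (T fun _ => 0)) ≠ (0 : MvPolynomial (Fin d × Fin 1) K) := by
      obtain ⟨I, hI⟩ := h0
      rw [hT] at hI
      exact left_ne_zero_of_mul hI
    refine ⟨1, fun i => X (Fin.cons i.1 fun _ => ⟨0, hmd⟩), fun i => isHomogeneous_X K _,
      C (algebraMap ℝ K (T fun _ => 0)) * X (⟨0, hmd⟩, 0) ^ k,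
      mul_ne_zero hc (pow_ne_zero _ (X_ne_zero _)), fun i => ?_⟩
    have hi : i = (i.1, 0) := Prod.ext rfl (Subsingleton.elim _ _)
    rw [aeval_X, hT, Fin.prod_univ_succ, hi]
    simp only [Fin.cons_zero, Fin.cons_succ, Finset.prod_const, Finset.card_univ,
      Fintype.card_fin]
    ring
  · obtain ⟨n, hn⟩ := exists_aeval_eq_of_embedding (d := d) hF
    choose s hs0 a hs using exists_embedding_of_two_le hm hmd
    choose G h hG hh hGF using fun i => hn (s i)
    -- `G i` yields row `i` times `h i`. Multiplying by the forms giving `h j * x_00` for all `j ≠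
    -- i` makes the factor `(∏ j, h j) * x_00 ^ (d - 1)` independent of `i`.
    refine ⟨n + ∑ _j ∈ Finset.univ.erase (⟨0, by omega⟩ : Fin d), n,
      fun i => G i.1 (a i.1, i.2) * ∏ j ∈ Finset.univ.erase i.1, G j (⟨0, by omega⟩, ⟨0, by omega⟩),
      fun i => ?_, (∏ j, h j) * X (⟨0, by omega⟩, ⟨0, by omega⟩) ^ (d - 1),
      mul_ne_zero (Finset.prod_ne_zero_iff.mpr fun j _ => hh j) (pow_ne_zero _ (X_ne_zero _)),
      fun i => ?_⟩
    · have := (hG i.1 (a i.1, i.2)).mul (IsHomogeneous.prod (Finset.univ.erase i.1)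
        (fun j => G j (⟨0, by omega⟩, ⟨0, by omega⟩)) (fun _ => n) fun j _ => hG j _)
      simpa using this
    · rw [map_mul, map_prod, hGF, hs, ← Finset.mul_prod_erase _ _ (Finset.mem_univ i.1)]
      simp only [hGF, hs0, Finset.prod_mul_distrib, Finset.prod_const, Finset.card_erase_of_mem,
        Finset.mem_univ, Finset.card_univ, Fintype.card_fin]
      ring

end Extension
end

noncomputable section

/-! ### Algebraic identifiability. -/

section Algebraic

/-- Transcendence degree is additive along `K ⊆ A ⊆ K[x]`, so it is maximal for `A` exactly when
`K[x]` is algebraic over `A`. -/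
lemma algebraicallyIdentifiable_iff {K : Type*} {ι τ : Type} [Field K] [Fintype ι]
    (F : τ → MvPolynomial ι K) :
    AlgebraicallyIdentifiable F ↔
      ∀ i, IsAlgebraic (Algebra.adjoin K (Set.range F)) (X i : MvPolynomial ι K) := by
  set A := Algebra.adjoin K (Set.range F) with hA
  have hdim : Algebra.trdeg K (MvPolynomial τ K ⧸ imageIdeal F) = Algebra.trdeg K A := by
    rw [hA, Algebra.adjoin_range_eq_range_aeval]
    exact (Ideal.quotientKerEquivRange (aeval F : MvPolynomial τ K →ₐ[K] _)).trdeg_eq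
  have hadd : Algebra.trdeg K A + Algebra.trdeg A (MvPolynomial ι K) = Fintype.card ι := by
    rw [trdeg_add_eq, trdeg_of_isDomain]
    simp
  have hiff : (∀ i, IsAlgebraic A (X i : MvPolynomial ι K)) ↔
      Algebra.IsAlgebraic A (MvPolynomial ι K) := by
    refine ⟨fun h => ⟨fun p => ?_⟩, fun h i => h.isAlgebraic _⟩
    induction p using MvPolynomial.induction_on with
    | C a => exact isAlgebraic_algebraMap (algebraMap K A a)
    | add p q hp hq => exact hp.add hq
    | mul_X p i hp => exact hp.mul (h i)
  have hlt : Algebra.trdeg K A < Cardinal.aleph0 :=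
    lt_of_le_of_lt (le_self_add.trans_eq hadd) (Cardinal.natCast_lt_aleph0)
  have hlt' : Algebra.trdeg A (MvPolynomial ι K) < Cardinal.aleph0 :=
    lt_of_le_of_lt (le_add_self.trans_eq hadd) (Cardinal.natCast_lt_aleph0)
  rw [hiff, ← trdeg_eq_zero_iff, AlgebraicallyIdentifiable, imageDim, hdim]
  obtain ⟨a, ha⟩ := Cardinal.lt_aleph0.mp hlt
  obtain ⟨b, hb⟩ := Cardinal.lt_aleph0.mp hlt'
  rw [ha, hb] at hadd
  have hab : a + b = Fintype.card ι := by exact_mod_cast hadd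
  rw [ha, hb, Cardinal.toNat_natCast, Nat.cast_eq_zero]
  omega

variable {K : Type*} [Field K] [Algebra ℝ K] {d k m : ℕ}

lemma isAlgebraic_X_of_embedding {T : (Fin k → Fin m) → ℝ}
    (hF : ∀ i, IsAlgebraic (Algebra.adjoin K (Set.range (tensorMap K m k m T)))
      (X i : MvPolynomial (Fin m × Fin m) K)) (s : Fin m ↪ Fin d) (a b : Fin m) :
    IsAlgebraic (Algebra.adjoin K (Set.range (tensorMap K d k m T)))
      (X (s a, b) : MvPolynomial (Fin d × Fin m) K) := by
  let φ : MvPolynomial (Fin m × Fin m) K →ₐ[K] MvPolynomial (Fin d × Fin m) K :=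
    rename (Prod.map s id)
  have hφ : Function.Injective φ :=
    rename_injective _ (s.injective.prodMap Function.injective_id)
  have hle : (Algebra.adjoin K (Set.range (tensorMap K m k m T))).map φ ≤
      Algebra.adjoin K (Set.range (tensorMap K d k m T)) := by
    rw [AlgHom.map_adjoin]
    refine Algebra.adjoin_mono ?_
    rintro _ ⟨_, ⟨I, rfl⟩, rfl⟩
    exact ⟨s ∘ I, (rename_tensorMap s k T I).symm⟩
  let f : Algebra.adjoin K (Set.range (tensorMap K m k m T)) →+*
      Algebra.adjoin K (Set.range (tensorMap K d k m T)) :=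
    (φ.toRingHom.comp (Subalgebra.val _).toRingHom).codRestrict _
      fun x => hle ⟨x, x.2, rfl⟩
  have := IsAlgebraic.ringHom_of_comp_eq f φ (hF (a, b))
    (fun x y hxy => Subtype.ext (hφ (congrArg Subtype.val hxy))) rfl
  simpa [φ] using this

/-- The product of `σ_i ^ r` with the entry lies in the algebra, and the nonzero algebraic factor
`σ_i ^ r` can be cancelled. -/
lemma isAlgebraic_tensorMap {T : ∀ k : ℕ, (Fin k → Fin m) → ℝ} (hT : IsShuffleFamily T)
    (hm : 1 ≤ m) (i : Fin d) (hk : 1 ≤ k) (r : ℕ) (w : Fin k → Fin d) :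
    IsAlgebraic (Algebra.adjoin K (Set.range (tensorMap K d (k + r) m (T (k + r)))))
      (tensorMap K d k m (T k) w) := by
  set A := Algebra.adjoin K (Set.range (tensorMap K d (k + r) m (T (k + r)))) with hA
  have hmem : ∀ p : MvPolynomial (Fin d × Fin m) K, p ∈ A → IsAlgebraic A p :=
    fun p hp => isAlgebraic_algebraMap (⟨p, hp⟩ : A)
  have hs : IsAlgebraic A (tensorMap K d 1 m (T 1) fun _ => i) := by
    refine IsAlgebraic.of_pow (n := k + r) (by omega) (hmem _ ?_)
    obtain ⟨q, hq⟩ : ∃ q, k + r = q + 1 := ⟨k + r - 1, by omega⟩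
    rw [hA, hq, tensorMap_one_pow hT]
    exact mul_mem (natCast_mem _ _) (Algebra.subset_adjoin ⟨_, rfl⟩)
  obtain ⟨L, -, hL⟩ := exists_isHomogeneous_aeval_tensorMap (K := K) hT i k r
  refine IsAlgebraic.of_mul (mem_nonZeroDivisors_of_ne_zero
    (pow_ne_zero r (tensorMap_one_ne_zero hT hm i))) (hs.pow r) (hmem _ ?_)
  rw [← hL w, hA, Algebra.adjoin_range_eq_range_aeval]
  exact ⟨_, rfl⟩

end Algebraic

/-! ### Passage from order 3 and `m` rows to order `k` and `d` rows. -/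

lemma exists_embedding_mem_range {d m : ℕ} (hm : 1 ≤ m) (hmd : m ≤ d) (i : Fin d) :
    ∃ (s : Fin m ↪ Fin d) (a : Fin m), s a = i :=
  ⟨(Fin.castLEEmb hmd).setValue ⟨0, hm⟩ i, ⟨0, hm⟩, by simp⟩

variable {K : Type*} [Field K] [Algebra ℝ K] {d k m : ℕ} {T : ∀ k : ℕ, (Fin k → Fin m) → ℝ}

theorem rationallyIdentifiable_tensorMap (hT : IsShuffleFamily T) (hm : 1 ≤ m) (hmd : m ≤ d)
    (hk : 3 ≤ k) (h : RationallyIdentifiable (tensorMap K m 3 m (T 3))) :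
    RationallyIdentifiable (tensorMap K d k m (T k)) := by
  obtain ⟨r, rfl⟩ := Nat.exists_eq_add_of_le hk
  let i : Fin d := ⟨0, by omega⟩
  have h3 : HasRationalInverse (tensorMap K d 3 m (T 3)) :=
    h.hasRationalInverse.tensorMap_of_le hm hmd (by omega)
      ⟨_, tensorMap_const_ne_zero hT hm i 2⟩
  obtain ⟨L, hL, hL'⟩ := exists_isHomogeneous_aeval_tensorMap (K := K) hT i 3 r
  refine (h3.of_aeval L hL (pow_ne_zero r (tensorMap_one_ne_zero hT hm i)) hL')
    |>.rationallyIdentifiable (tensorMap_isHomogeneous _ _) ?_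
  rw [show 3 + r = r + 2 + 1 by omega]
  exact ⟨_, tensorMap_const_ne_zero hT hm i _⟩

theorem algebraicallyIdentifiable_tensorMap (hT : IsShuffleFamily T) (hm : 1 ≤ m) (hmd : m ≤ d)
    (hk : 3 ≤ k) (h : AlgebraicallyIdentifiable (tensorMap K m 3 m (T 3))) :
    AlgebraicallyIdentifiable (tensorMap K d k m (T k)) := by
  obtain ⟨r, rfl⟩ := Nat.exists_eq_add_of_le hk
  rw [algebraicallyIdentifiable_iff] at h ⊢
  rintro ⟨i, b⟩
  obtain ⟨s, a, rfl⟩ := exists_embedding_mem_range hm hmd i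
  refine IsAlgebraic.adjoin_of_forall_isAlgebraic ?_ (isAlgebraic_X_of_embedding h s a b)
  rintro _ ⟨⟨w, rfl⟩, -⟩
  exact isAlgebraic_tensorMap hT hm (s a) (by omega) r w

end

theorem proposition6p8 (K : Type*) [Field K] [IsAlgClosed K] [Algebra ℝ K]
    (d k m : ℕ) (hm : 1 ≤ m) (hmd : m ≤ d) (hk : 3 ≤ k) :
    ((RationallyIdentifiable (plSignatureMap K m 3 m) →
        RationallyIdentifiable (plSignatureMap K d k m)) ∧
      (AlgebraicallyIdentifiable (plSignatureMap K m 3 m) →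
        AlgebraicallyIdentifiable (plSignatureMap K d k m))) ∧
    ((RationallyIdentifiable (polySignatureMap K m 3 m) →
        RationallyIdentifiable (polySignatureMap K d k m)) ∧
      (AlgebraicallyIdentifiable (polySignatureMap K m 3 m) →
        AlgebraicallyIdentifiable (polySignatureMap K d k m))) :=
  ⟨⟨rationallyIdentifiable_tensorMap (isShuffleFamily_axisPath m) hm hmd hk,
    algebraicallyIdentifiable_tensorMap (isShuffleFamily_axisPath m) hm hmd hk⟩,
   rationallyIdentifiable_tensorMap (isShuffleFamily_monomialPath m) hm hmd hk,
   algebraicallyIdentifiable_tensorMap (isShuffleFamily_monomialPath m) hm hmd hk⟩
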